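/- **Theorem (maximum theorem).** Let $\mathcal M_\theta$ be a non-empty smooth $n$-dimensional manifold without boundary (the manifold of macroscopic observables $I$ accessible at the fixed control parameters $\theta$), with a smooth Riemannian metric $g$, and let $\mathcal S_g(\cdot|\theta):\mathcal M_\theta\to\mathbb R$ be a differentiable function (the scalar entropy). A *unit geodesic* is a $C^1$ curve $I_g:[a,b]\to\mathcal M_\theta$, $a<b$, with $g(\dot I_g,\dot I_g)=1$, whose length is minimal among the $C^1$ curves with the same end points; its *entropy production* is $\Phi(t)=\frac{d}{dt}\mathcal S_g[I_g(t)|\theta]$. In a coordinate system $(I^1,\dots,I^n)$ let $g_{ij}$ be the components of $g$ and $$\rho(I|\theta)=e^{\mathcal S_g(I|\theta)}\sqrt{\left|\det\left(g_{ij}(I|\theta)/2\pi\right)\right|}$$ the density of the distribution $dp=e^{\mathcal S_g}\,d\mu$, $d\mu=\sqrt{|\det (g_{ij}/2\pi)|}\,dI$. A point $I$ is said to tend to the boundary $\partial\mathcal M_\theta$ when it leaves every compact subset of $\mathcal M_\theta$; this is the ideal boundary, not contained in $\mathcal M_\theta$ (for an open subset of $\mathbb R^n$: when it tends to its frontier or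 to infinity). Assume: 1. (geodesic connectivity) any two distinct points of $\mathcal M_\theta$ are the end points of a unit geodesic; 2. (Axiom 3) for every unit geodesic $I_g$ on $[a,b]$ and all $a\le t_1\le t_2\le b$, the length of $I_g$ on $[t_1,t_2]$ equals $\Phi(t_1)-\Phi(t_2)$; 3. (Axiom 4) $\mathcal M_\theta$ is covered by finitely many smooth coordinate systems (for example, one global one) such that in each of them $\rho$ and all its first partial derivatives $\partial\rho/\partial I^i$ tend to $0$ as $I\to\partial\mathcal M_\theta$, and in each of which the metric does not degenerate at the boundary, i.e. $|\det g_{ij}|\ge c$ for some constant $c>0$ as $I\to\partial\mathcal M_\theta$. Then $d^2\mathcal S_g/ds^2=d\Phi/ds=-1$ along every unit geodesic, and $\mathcal S_g(\cdot|\theta)$ has exactly one stationary point $\bar I$ (a point where $d\mathcal S_g=0$); moreover $\mathcal S_g(I|\theta)\le\mathcal S_g(\bar I|\theta)$ for all $I\in\mathcal M_\theta$. -/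

import Mathlib

open Set Filter Topology Bundle Manifold
open scoped Manifold ContDiff ENNReal

namespace ThermoGeometry

noncomputable section

section Coordinates

variable {n : ℕ} {M : Type*} [TopologicalSpace M] [ChartedSpace (EuclideanSpace ℝ (Fin n)) M]
  [RiemannianBundle (fun p : M => TangentSpace (𝓡 n) p)]

/-- The coordinate vector `∂/∂Iⁱ` of the coordinate system `φ`, at the point with coordinates `x`. -/
def coordVector (φ : OpenPartialHomeomorph M (EuclideanSpace ℝ (Fin n)))
    (x : EuclideanSpace ℝ (Fin n)) (i : Fin n) : TangentSpace (𝓡 n) (φ.symm x) :=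
  mfderiv (𝓡 n) (𝓡 n) φ.symm x (EuclideanSpace.single i (1 : ℝ) : EuclideanSpace ℝ (Fin n))

/-- The components `g_ij` of the metric tensor in the coordinate system `φ`. -/
def metricMatrix (φ : OpenPartialHomeomorph M (EuclideanSpace ℝ (Fin n)))
    (x : EuclideanSpace ℝ (Fin n)) : Matrix (Fin n) (Fin n) ℝ :=
  Matrix.of fun i j => inner ℝ (coordVector φ x i) (coordVector φ x j)

/-- The probability density in the coordinate system `φ`: the density
`ρ = exp(S) √|g_ij / 2π|` of `dp = exp(S) dμ` with respect to `dI`. -/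
def density (S : M → ℝ) (φ : OpenPartialHomeomorph M (EuclideanSpace ℝ (Fin n)))
    (x : EuclideanSpace ℝ (Fin n)) : ℝ :=
  Real.exp (S (φ.symm x)) * √|((2 * Real.pi)⁻¹ • metricMatrix φ x).det|

/-- The filter of points of the domain of `φ` that approach the boundary of the (open) manifold `M`,
that is, that leave every compact subset of `M`. If `M` is an open subset of `ℝⁿ` with `φ` the
identity, these are the points that approach the frontier of `M` or infinity. -/
def toBoundary (φ : OpenPartialHomeomorph M (EuclideanSpace ℝ (Fin n))) : Filter M :=
  cocompact M ⊓ 𝓟 φ.source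

/-- The probability density and its first partial derivatives, in the coordinate system `φ`,
vanish on the boundary. -/
def DensityVanishesAtBoundary (S : M → ℝ)
    (φ : OpenPartialHomeomorph M (EuclideanSpace ℝ (Fin n))) : Prop :=
  Tendsto (fun p => density S φ (φ p)) (toBoundary φ) (𝓝 0) ∧
  ∀ i : Fin n, Tendsto
    (fun p => fderiv ℝ (density S φ) (φ p) (EuclideanSpace.single i (1 : ℝ)))
    (toBoundary φ) (𝓝 0)

/-- The metric tensor, in the coordinate system `φ`, does not degenerate at the boundary:
its determinant stays away from zero there. -/
def MetricNondegenerateAtBoundary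
    (φ : OpenPartialHomeomorph M (EuclideanSpace ℝ (Fin n))) : Prop :=
  ∃ c : ℝ, 0 < c ∧ ∀ᶠ p in toBoundary φ, c ≤ |(metricMatrix φ (φ p)).det|

/-- A finite family of smooth coordinate systems that covers the manifold (for instance, one global
coordinate system). -/
def IsCoordinateRepresentation (A : Set (OpenPartialHomeomorph M (EuclideanSpace ℝ (Fin n)))) :
    Prop :=
  A.Finite ∧ (∀ φ ∈ A, φ ∈ IsManifold.maximalAtlas (𝓡 n) ∞ M) ∧ ∀ p : M, ∃ φ ∈ A, p ∈ φ.source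

end Coordinates

section Geodesics

variable (n : ℕ) {M : Type*} [TopologicalSpace M] [ChartedSpace (EuclideanSpace ℝ (Fin n)) M]
  [RiemannianBundle (fun p : M => TangentSpace (𝓡 n) p)]

/-- A geodesic with unitary affine parametrization on `[a, b]`: a `C¹` curve of unit speed whose
length is minimal among the `C¹` curves with the same extreme points. -/
structure IsUnitGeodesic (γ : ℝ → M) (a b : ℝ) : Prop where
  lt : a < b
  contMDiffOn : ContMDiffOn 𝓘(ℝ, ℝ) (𝓡 n) 1 γ (Icc a b)
  unit_speed : ∀ t ∈ Icc a b, ‖mfderivWithin 𝓘(ℝ, ℝ) (𝓡 n) γ (Icc a b) t (1 : ℝ)‖ = 1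
  minimal : pathELength (𝓡 n) γ a b = riemannianEDist (𝓡 n) (γ a) (γ b)

variable (M) in
/-- Any two distinct points are joined by a geodesic. -/
def GeodesicallyConnected : Prop :=
  ∀ P Q : M, P ≠ Q → ∃ (γ : ℝ → M) (a b : ℝ), IsUnitGeodesic n γ a b ∧ γ a = P ∧ γ b = Q

/-- The entropy production `Φ(t) = d S[I(t)] / dt` along a curve defined on `[a, b]`. -/
def entropyProduction {M : Type*} (S : M → ℝ) (γ : ℝ → M) (a b t : ℝ) : ℝ :=
  derivWithin (fun s => S (γ s)) (Icc a b) t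

/-- The length of any interval of any unit-speed geodesic is the variation of the entropy
production with opposite sign. -/
def LengthEqEntropyProductionDrop (S : M → ℝ) : Prop :=
  ∀ (γ : ℝ → M) (a b : ℝ), IsUnitGeodesic n γ a b →
    ∀ t₁ t₂ : ℝ, a ≤ t₁ → t₁ ≤ t₂ → t₂ ≤ b →
      (pathELength (𝓡 n) γ t₁ t₂).toReal =
        entropyProduction S γ a b t₁ - entropyProduction S γ a b t₂

/-- A stationary point of the differentiable function `S`. -/
def IsStationaryPoint (S : M → ℝ) (p : M) : Prop :=
  mfderiv (𝓡 n) 𝓘(ℝ, ℝ) S p = 0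

end Geodesics

end

end ThermoGeometry

/-!
Along a unit geodesic the length of `[t₁, t₂]` is `t₂ - t₁`, so the entropy production `Φ` satisfies
`Φ t₁ - Φ t₂ = t₂ - t₁`: it is affine with slope `-1` (`entropyProduction_sub_eq`). At a stationary
point of the entropy `Φ` vanishes, by the chain rule (`entropyProduction_eq_zero`); a geodesic joining
two distinct stationary points would have `Φ` equal to zero at both ends, which its slope excludes.

Existence comes from the boundary conditions. In each coordinate system
`ρ = exp(S) (2π)^(-n/2) √|det g|`; since `ρ → 0` and `|det g|` is bounded below near the boundary,
`exp(S) → 0` there. The finitely many coordinate systems cover `M`, so `exp(S)` tends to zero along the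
cocompact filter of `M` (`tendsto_exp_cocompact`). A continuous positive function that tends to zero
along the cocompact filter attains its maximum, and `S` is stationary there because `M` has no
boundary. When `M` is compact the cocompact filter is trivial and the argument still applies.
-/

namespace ThermoGeometry

section Geodesics

variable {n : ℕ} {M : Type*} [TopologicalSpace M] [ChartedSpace (EuclideanSpace ℝ (Fin n)) M]

theorem IsUnitGeodesic.pathELength_eq [RiemannianBundle (fun p : M => TangentSpace (𝓡 n) p)]
    {γ : ℝ → M} {a b t₁ t₂ : ℝ} (hγ : IsUnitGeodesic n γ a b) (h₁ : a ≤ t₁) (h₂ : t₂ ≤ b) :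
    pathELength (𝓡 n) γ t₁ t₂ = ENNReal.ofReal (t₂ - t₁) := by
  rw [pathELength_eq_lintegral_mfderiv_Ioo, ← Real.volume_Ioo, ← MeasureTheory.setLIntegral_one]
  refine MeasureTheory.setLIntegral_congr_fun measurableSet_Ioo fun t ht => ?_
  have hat : a < t := h₁.trans_lt ht.1
  have htb : t < b := ht.2.trans_le h₂
  -- On the open interval the derivative within `[a, b]` is the derivative in the definition of length.
  have h := hγ.unit_speed t ⟨hat.le, htb.le⟩
  rw [mfderivWithin_of_mem_nhds (Icc_mem_nhds hat htb)] at h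
  rw [← ofReal_norm]
  exact (congrArg ENNReal.ofReal h).trans ENNReal.ofReal_one

theorem entropyProduction_sub_eq [RiemannianBundle (fun p : M => TangentSpace (𝓡 n) p)]
    {S : M → ℝ} (hlength : LengthEqEntropyProductionDrop n S)
    {γ : ℝ → M} {a b t₁ t₂ : ℝ} (hγ : IsUnitGeodesic n γ a b)
    (h₁ : a ≤ t₁) (h₁₂ : t₁ ≤ t₂) (h₂ : t₂ ≤ b) :
    entropyProduction S γ a b t₁ - entropyProduction S γ a b t₂ = t₂ - t₁ := by
  rw [← hlength γ a b hγ t₁ t₂ h₁ h₁₂ h₂, hγ.pathELength_eq h₁ h₂,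
    ENNReal.toReal_ofReal (sub_nonneg.2 h₁₂)]

theorem hasDerivWithinAt_entropyProduction [RiemannianBundle (fun p : M => TangentSpace (𝓡 n) p)]
    {S : M → ℝ} (hlength : LengthEqEntropyProductionDrop n S)
    {γ : ℝ → M} {a b t : ℝ} (hγ : IsUnitGeodesic n γ a b) (ht : t ∈ Icc a b) :
    HasDerivWithinAt (entropyProduction S γ a b) (-1) (Icc a b) t := by
  have key : ∀ s ∈ Icc a b,
      entropyProduction S γ a b s = entropyProduction S γ a b a + a - s := fun s hs => by
    linarith [entropyProduction_sub_eq hlength hγ le_rfl hs.1 hs.2]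
  exact ((hasDerivAt_id t).const_sub _).hasDerivWithinAt.congr key (key t ht)

theorem entropyProduction_eq_zero {S : M → ℝ} (hS : MDifferentiable (𝓡 n) 𝓘(ℝ, ℝ) S)
    {γ : ℝ → M} {a b t : ℝ} (hab : a < b) (ht : t ∈ Icc a b)
    (hγ : MDifferentiableWithinAt 𝓘(ℝ, ℝ) (𝓡 n) γ (Icc a b) t)
    (hst : IsStationaryPoint n S (γ t)) : entropyProduction S γ a b t = 0 := by
  have hcomp := mfderiv_comp_mfderivWithin t (hS (γ t)) hγ
    (uniqueDiffOn_Icc hab t ht).uniqueMDiffWithinAt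
  rw [show mfderiv (𝓡 n) 𝓘(ℝ, ℝ) S (γ t) = 0 from hst, ContinuousLinearMap.zero_comp,
    mfderivWithin_eq_fderivWithin] at hcomp
  exact DFunLike.congr_fun hcomp (1 : ℝ)

theorem IsStationaryPoint.eq_of_geodesicallyConnected
    [RiemannianBundle (fun p : M => TangentSpace (𝓡 n) p)]
    {S : M → ℝ} (hS : MDifferentiable (𝓡 n) 𝓘(ℝ, ℝ) S) (hconn : GeodesicallyConnected n M)
    (hlength : LengthEqEntropyProductionDrop n S) {p q : M}
    (hp : IsStationaryPoint n S p) (hq : IsStationaryPoint n S q) : p = q := by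
  by_contra hpq
  obtain ⟨γ, a, b, hγ, rfl, rfl⟩ := hconn p q hpq
  have hd := hγ.contMDiffOn.mdifferentiableOn one_ne_zero
  have ha := left_mem_Icc.2 hγ.lt.le
  have hb := right_mem_Icc.2 hγ.lt.le
  linarith [hγ.lt, entropyProduction_sub_eq hlength hγ le_rfl hγ.lt.le le_rfl,
    entropyProduction_eq_zero hS hγ.lt ha (hd a ha) hp,
    entropyProduction_eq_zero hS hγ.lt hb (hd b hb) hq]

/-- Fermat's theorem on a manifold without boundary, read off in the preferred chart at the point. -/
theorem isStationaryPoint_of_forall_le {S : M → ℝ} {p : M}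
    (hS : MDifferentiableAt (𝓡 n) 𝓘(ℝ, ℝ) S p) (hp : ∀ q, S q ≤ S p) :
    IsStationaryPoint n S p := by
  have hmax : IsLocalMax (writtenInExtChartAt (𝓡 n) 𝓘(ℝ, ℝ) p S) (extChartAt (𝓡 n) p p) :=
    Eventually.of_forall fun x => by
      simpa only [writtenInExtChartAt, extChartAt_model_space_eq_id, PartialEquiv.refl_coe,
        Function.comp_apply, id_eq, extChartAt_to_inv] using hp _
  rw [IsStationaryPoint, hS.mfderiv, ModelWithCorners.range_eq_univ, fderivWithin_univ]
  exact hmax.fderiv_eq_zero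

end Geodesics

section Boundary

variable {n : ℕ} {M : Type*} [TopologicalSpace M] [ChartedSpace (EuclideanSpace ℝ (Fin n)) M]

theorem tendsto_exp_toBoundary [RiemannianBundle (fun p : M => TangentSpace (𝓡 n) p)]
    {S : M → ℝ}
    {φ : OpenPartialHomeomorph M (EuclideanSpace ℝ (Fin n))}
    (hnondeg : MetricNondegenerateAtBoundary φ)
    (hρ : Tendsto (fun p => density S φ (φ p)) (toBoundary φ) (𝓝 0)) :
    Tendsto (fun p => Real.exp (S p)) (toBoundary φ) (𝓝 0) := by
  obtain ⟨c, hc, hdet⟩ := hnondeg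
  have hpi : (0 : ℝ) < (2 * Real.pi)⁻¹ ^ n := by positivity
  have hK : 0 < √((2 * Real.pi)⁻¹ ^ n * c) := Real.sqrt_pos.2 (mul_pos hpi hc)
  have hρ' := hρ.div_const √((2 * Real.pi)⁻¹ ^ n * c)
  rw [zero_div] at hρ'
  have hsource : ∀ᶠ p in toBoundary φ, p ∈ φ.source :=
    mem_inf_of_right (mem_principal_self _)
  refine squeeze_zero' (Eventually.of_forall fun p => (Real.exp_pos _).le) ?_ hρ'
  filter_upwards [hsource, hdet] with p hp hcp
  -- The claim is `exp (S p) ≤ ρ / √((2π)⁻ⁿ c)`, where `ρ = exp (S p) √((2π)⁻ⁿ |det g|)`.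
  rw [le_div_iff₀ hK, density, φ.left_inv hp, Matrix.det_smul, Fintype.card_fin, abs_mul,
    abs_of_pos hpi]
  gcongr

theorem IsCoordinateRepresentation.cocompact_le
    {A : Set (OpenPartialHomeomorph M (EuclideanSpace ℝ (Fin n)))}
    (hA : IsCoordinateRepresentation A) :
    cocompact M ≤ ⨆ φ ∈ A, toBoundary φ := by
  intro s hs
  simp only [mem_iSup, toBoundary, mem_inf_principal] at hs
  filter_upwards [(biInter_mem hA.1).2 hs] with p hp
  obtain ⟨φ, hφ, hpφ⟩ := hA.2.2 p
  exact mem_iInter₂.1 hp φ hφ hpφ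

theorem tendsto_exp_cocompact [RiemannianBundle (fun p : M => TangentSpace (𝓡 n) p)]
    {S : M → ℝ}
    {A : Set (OpenPartialHomeomorph M (EuclideanSpace ℝ (Fin n)))}
    (hA : IsCoordinateRepresentation A)
    (hnondeg : ∀ φ ∈ A, MetricNondegenerateAtBoundary φ)
    (hboundary : ∀ φ ∈ A, DensityVanishesAtBoundary S φ) :
    Tendsto (fun p => Real.exp (S p)) (cocompact M) (𝓝 0) :=
  (tendsto_iSup.2 fun φ => tendsto_iSup.2 fun hφ =>
    tendsto_exp_toBoundary (hnondeg φ hφ) (hboundary φ hφ).1).mono_left hA.cocompact_le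

end Boundary

end ThermoGeometry

theorem mainTheorem6 {n : ℕ} {M : Type*} [TopologicalSpace M] [T2Space M]
    [SecondCountableTopology M] [Nonempty M]
    [ChartedSpace (EuclideanSpace ℝ (Fin n)) M] [IsManifold (𝓡 n) ∞ M]
    [RiemannianBundle (fun p : M => TangentSpace (𝓡 n) p)]
    [IsContMDiffRiemannianBundle (𝓡 n) ∞ (EuclideanSpace ℝ (Fin n))
      (fun p : M => TangentSpace (𝓡 n) p)]
    (S : M → ℝ) (hS : MDifferentiable (𝓡 n) 𝓘(ℝ, ℝ) S)
    (hconn : ThermoGeometry.GeodesicallyConnected n M)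
    (hlength : ThermoGeometry.LengthEqEntropyProductionDrop n S)
    (A : Set (OpenPartialHomeomorph M (EuclideanSpace ℝ (Fin n))))
    (hA : ThermoGeometry.IsCoordinateRepresentation A)
    (hnondeg : ∀ φ ∈ A, ThermoGeometry.MetricNondegenerateAtBoundary φ)
    (hboundary : ∀ φ ∈ A, ThermoGeometry.DensityVanishesAtBoundary S φ) :
    (∀ (γ : ℝ → M) (a b : ℝ), ThermoGeometry.IsUnitGeodesic n γ a b →
      ∀ t ∈ Icc a b,
        HasDerivWithinAt (ThermoGeometry.entropyProduction S γ a b) (-1) (Icc a b) t) ∧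
    ∃ Ibar : M, ThermoGeometry.IsStationaryPoint n S Ibar ∧
      (∀ p : M, ThermoGeometry.IsStationaryPoint n S p → p = Ibar) ∧
      ∀ p : M, S p ≤ S Ibar := by
  refine ⟨fun γ a b hγ t ht =>
    ThermoGeometry.hasDerivWithinAt_entropyProduction hlength hγ ht, ?_⟩
  obtain ⟨p₀⟩ := ‹Nonempty M›
  obtain ⟨Ibar, hmax⟩ := (Real.continuous_exp.comp hS.continuous).exists_forall_ge' p₀ <|
    (ThermoGeometry.tendsto_exp_cocompact hA hnondeg hboundary).eventually_le_const
      (Real.exp_pos (S p₀))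
  have hle : ∀ p, S p ≤ S Ibar := fun p => Real.exp_le_exp.1 (hmax p)
  have hstat := ThermoGeometry.isStationaryPoint_of_forall_le (hS Ibar) hle
  exact ⟨Ibar, hstat, fun p hp => hp.eq_of_geodesicallyConnected hS hconn hlength hstat, hle⟩
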